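/- Let $s\in\mathbb N$, let $U$ be an $s\times s$ complex unitary matrix, let $r_1,\dots,r_s\in\mathbb R$ and $n_1,\dots,n_s\in\mathbb N$. Consider the Gaussian boson sampling circuit on $s$ modes (each mode being $L^2(\mathbb R)$) in which the squeezed vacua $S(r_1)|0\rangle,\dots,S(r_s)|0\rangle$ enter a linear interferometer with matrix $U$. Here: - $|n\rangle$ is the Hermite function $\psi_n(x)=(2^n n!\sqrt\pi)^{-1/2}H_n(x)e^{-x^2/2}$, with $H_n$ the physicists' Hermite polynomial, and $S(r)$ is the unitary squeeze gate $(S(r)f)(x)=e^{r/2}f(e^{r}x)$; - the interferometer $\mathcal U$ is the diagram in which input $i$ is split by a W node into $s$ wires, the wire from input $i$ to output $j$ carries $U_{ji}^{\hat n}=\sum_k U_{ji}^k|k\rangle\langle k|$, and the wires arriving at output $j$ are merged by a W node; the W node is $\sum_{k_1,\dots,k_s\ge 0}\sqrt{\frac{(\sum_a k_a)!}{\prod_a k_a!}}\;|\sum_a k_a\rangle\langle k_1,\dots,k_s|$ for merging, and its transpose for splitting. Equivalently, $$\langle n_1,\dots,n_s|\,\mathcal U\,|m_1,\dots,m_s\rangle=\sum_{K}\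 \prod_i\sqrt{\frac{m_i!}{\prod_j K_{ij}!}}\ \prod_j\sqrt{\frac{n_j!}{\prod_i K_{ij}!}}\ \prod_{i,j}U_{ji}^{K_{ij}},$$ where $K$ runs over the $s\times s$ matrices of natural numbers with row sums $m_i$ and column sums $n_j$. Then the sum over all photon-number labellings of the internal wires which defines the amplitude $\langle n_1,\dots,n_s|\,\mathcal U\,\bigotimes_i S(r_i)|0\rangle$ of observing $n_1,\dots,n_s$ photons converges unconditionally, and $$\langle n_1,\dots,n_s|\,\mathcal U\,\bigotimes_{i=1}^s S(r_i)|0\rangle=(-1)^{\lfloor N/2\rfloor}\;\prod_{i=1}^s\frac{1}{\sqrt{\cosh r_i}}\;\prod_{i=1}^s\frac1{\sqrt{n_i!}}\;\operatorname{haf}(A_n),\qquad N=\sum_i n_i,$$ where $A=U\big(\bigoplus_{i=1}^s\tanh r_i\big)U^{T}$ and $A_n$ is the $N\times N$ matrix obtained from $A$ by repeating the $i$-th row and column $n_i$ times for each $i$. The hafnian of a symmetric matrix is $\operatorname{haf}(B)=\sum_\rho\prod_{\{i,j\}\in\rho}b_{ij}$, where $\rho$ runs over all partitions of the index set into two-element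 subsets; it is $0$ for odd size and $1$ for size $0$. -/

import Mathlib

open scoped BigOperators Nat

/-! ### Single-mode wave functions

A mode is a copy of `L²(ℝ)`; wave functions are written as functions `ℝ → ℂ`. -/

/-- The physicists' Hermite polynomial `H_n(x) = 2^{n/2} He_n(√2 x)`, where `He_n` is Mathlib's
(probabilists') Hermite polynomial. -/
noncomputable def physHermite (n : ℕ) (x : ℝ) : ℝ :=
  (√2) ^ n * Polynomial.aeval (√2 * x) (Polynomial.hermite n)

/-- The number state `|n⟩`, i.e. the Hermite function
`ψ_n(x) = (2^n n! √π)^{-1/2} H_n(x) e^{-x²/2}`. -/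
noncomputable def fockState (n : ℕ) (x : ℝ) : ℂ :=
  (((√(2 ^ n * n ! * √Real.pi))⁻¹ * physHermite n x * Real.exp (-x ^ 2 / 2) : ℝ) : ℂ)

/-- The Fock coefficient `⟨n|f⟩`, the `L²(ℝ)` inner product of `ψ_n` with `f`. -/
noncomputable def fockCoeff (f : ℝ → ℂ) (n : ℕ) : ℂ :=
  ∫ x : ℝ, (starRingEnd ℂ) (fockState n x) * f x

/-- The multiplier `∫ |m x⟩⟨x| dx` (for `m ≠ 0`), acting on wave functions by
`f ↦ |m|⁻¹ f(x / m)`. -/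
noncomputable def multiplier (m : ℝ) (f : ℝ → ℂ) (x : ℝ) : ℂ :=
  ((|m|⁻¹ : ℝ) : ℂ) * f (x / m)

/-- The squeeze gate `S(r)`: the multiplier labelled by `e^{-r}`, normalised to be unitary.
Thus `(S(r) f)(x) = e^{r/2} f(e^r x)`. -/
noncomputable def squeezeGate (r : ℝ) (f : ℝ → ℂ) (x : ℝ) : ℂ :=
  ((√(Real.exp (-r)) : ℝ) : ℂ) * multiplier (Real.exp (-r)) f x

/-- The squeezed vacuum state `S(r)|0⟩`. -/
noncomputable def squeezedVacuum (r : ℝ) : ℝ → ℂ :=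
  squeezeGate r (fockState 0)

/-! ### Fock-basis components of the nodes of a diagram -/

/-- The component of the W node at the label `n` on its single leg and the labels `k` on its
other legs: `√((∑ k)! / ∏ k!)` if `n = ∑ k`, and `0` otherwise.  The node and its transpose
have the same components. -/
noncomputable def wNode {κ : Type*} [Fintype κ] (n : ℕ) (k : κ → ℕ) : ℂ :=
  if n = ∑ a, k a then ((√(((∑ a, k a)! : ℝ) / ∏ a, ((k a)! : ℝ)) : ℝ) : ℂ) else 0

/-- The component at `(k, l)` of the Fock spider `∑ n, g(n) |n⟩⟨n|` with one input and one
output. -/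
def fockSpider (g : ℕ → ℂ) (k l : ℕ) : ℂ :=
  if k = l then g k else 0

/-! ### The Gaussian boson sampling circuit -/

/-- The contribution to the amplitude of one labelling of the internal wires by photon numbers.
Squeezed vacua `S(r i)|0⟩` enter the interferometer with matrix `U`: the input `i` is split by a
W node, the wire `(i, j)` from input `i` to output `j` carries the Fock spider `(U j i)^n̂`, and
the wires arriving at output `j` are merged by a W node.  The labels are `m i` on the `i`-th input
wire, `k (i, j)` and `l (i, j)` on the wire `(i, j)` before and after its spider, and the observed
photon number `n j` on the `j`-th output wire. -/
noncomputable def gbsTerm {s : ℕ} (U : Matrix (Fin s) (Fin s) ℂ) (r : Fin s → ℝ) (n : Fin s → ℕ)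
    (w : (Fin s → ℕ) × (Fin s × Fin s → ℕ) × (Fin s × Fin s → ℕ)) : ℂ :=
  (∏ i, fockCoeff (squeezedVacuum (r i)) (w.1 i)) *
    (∏ i, wNode (w.1 i) (fun j => w.2.1 (i, j))) *
    (∏ e : Fin s × Fin s, fockSpider (fun p => (U e.2 e.1) ^ p) (w.2.1 e) (w.2.2 e)) *
    (∏ j, wNode (n j) (fun i => w.2.2 (i, j)))

/-- The amplitude of observing `n j` photons in each output mode `j`. -/
noncomputable def gbsAmplitude {s : ℕ} (U : Matrix (Fin s) (Fin s) ℂ) (r : Fin s → ℝ)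
    (n : Fin s → ℕ) : ℂ :=
  ∑' w, gbsTerm U r n w

/-! ### Hafnians -/

/-- `M` is a partition of `ι` into two-element subsets: its members are pairs of distinct
elements and every element lies in exactly one of them. -/
def IsPairing {ι : Type*} (M : Finset (Sym2 ι)) : Prop :=
  (∀ e ∈ M, ¬ e.IsDiag) ∧ ∀ v : ι, ∃! e, e ∈ M ∧ v ∈ e

open Classical in
/-- The hafnian of a symmetric matrix: the sum over all partitions of the index set into pairs
`{i, j}` of the product of the entries `A i j`. It vanishes for an index set of odd size. -/
noncomputable def hafnian {ι : Type*} [Fintype ι] (A : Matrix ι ι ℂ) (hA : A.IsSymm) : ℂ :=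
  ∑ M : Finset (Sym2 ι) with IsPairing M,
    ∏ e ∈ M, Sym2.lift ⟨fun i j => A i j, fun i j => (hA.apply i j).symm⟩ e

/-- The matrix `U (⨁ i, tanh (r i)) Uᵀ`. -/
noncomputable def gbsMatrix {s : ℕ} (U : Matrix (Fin s) (Fin s) ℂ) (r : Fin s → ℝ) :
    Matrix (Fin s) (Fin s) ℂ :=
  U * Matrix.diagonal (fun i => ((Real.tanh (r i) : ℝ) : ℂ)) * U.transpose

/-- The matrix obtained from `A` by repeating the `i`-th row and column `n i` times. -/
def repeatMatrix {s : ℕ} (A : Matrix (Fin s) (Fin s) ℂ) (n : Fin s → ℕ) :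
    Matrix (Σ i, Fin (n i)) (Σ i, Fin (n i)) ℂ :=
  A.submatrix Sigma.fst Sigma.fst

theorem gbsMatrix_isSymm {s : ℕ} (U : Matrix (Fin s) (Fin s) ℂ) (r : Fin s → ℝ) :
    (gbsMatrix U r).IsSymm := by
  simp [Matrix.IsSymm, gbsMatrix, Matrix.transpose_mul, Matrix.mul_assoc]

theorem repeatMatrix_isSymm {s : ℕ} {A : Matrix (Fin s) (Fin s) ℂ} (hA : A.IsSymm)
    (n : Fin s → ℕ) : (repeatMatrix A n).IsSymm :=
  hA.submatrix _

/-! ### Moments of a centred Gaussian -/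

/-! The `n`-th Fock coefficient of a squeezed vacuum is `1/√(cosh r) · 1/√(n!)` times the `n`-th
moment of a Gaussian of variance `-tanh r` (`fockCoeff_squeezedVacuum`). The variance may be
negative, so expectations are taken through an algebraic functional on polynomials.

Fixing the outputs leaves finitely many nonzero terms (`gbsTerm_eq_zero`), hence convergence. In
these the factorials at the inputs cancel and the others form multinomial coefficients, so the sum
expands the expectation of `∏ j, (∑ i, U j i X i) ^ n j` for independent `X i` of variance `-tanh (r
i)`. Wick's theorem (`gaussianFunctional_prod_linear`) turns this into a sum over pairings of
products of the covariances `-A i j`. Extracting the signs leaves the hafnian. -/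

/-- The `n`-th moment of a centred Gaussian of (formal) variance `x`, i.e. `(n - 1)‼ x ^ (n / 2)` for even
`n` and `0` for odd `n`. -/
def gaussianMoment {R : Type*} [CommRing R] (x : R) : ℕ → R
  | 0 => 1
  | 1 => 0
  | n + 2 => (n + 1) * x * gaussianMoment x n

theorem gaussianMoment_ofReal (x : ℝ) (n : ℕ) :
    ((gaussianMoment x n : ℝ) : ℂ) = gaussianMoment (x : ℂ) n := by
  induction n using Nat.twoStepInduction with
  | zero => simp [gaussianMoment]
  | one => simp [gaussianMoment]
  | more n ih _ => simp [gaussianMoment, ih]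

/-! ### Fock coefficients of the squeezed vacuum -/

section Gaussian

open Polynomial MeasureTheory

theorem integrable_polynomial_mul_gaussian {a : ℝ} (ha : 0 < a) (P : ℝ[X]) :
    Integrable fun x : ℝ => P.eval x * Real.exp (-a * x ^ 2) := by
  induction P using Polynomial.induction_on' with
  | add p q hp hq =>
    simp only [eval_add, add_mul]
    exact hp.add hq
  | monomial n c =>
    have h := (integrable_rpow_mul_exp_neg_mul_sq ha (s := n)
      (by have : (0 : ℝ) ≤ n := n.cast_nonneg
          linarith)).const_mul c
    simpa [Real.rpow_natCast, mul_assoc] using h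

/-- The derivative of `P(x) exp(-a x²)` is integrable and integrates to zero. -/
theorem integral_derivative_mul_gaussian {a : ℝ} (ha : 0 < a) (P : ℝ[X]) :
    ∫ x : ℝ, (derivative P).eval x * Real.exp (-a * x ^ 2) =
      2 * a * ∫ x : ℝ, (X * P).eval x * Real.exp (-a * x ^ 2) := by
  have hd : ∀ x : ℝ, HasDerivAt (fun x : ℝ => P.eval x * Real.exp (-a * x ^ 2))
      ((derivative P - C (2 * a) * (X * P)).eval x * Real.exp (-a * x ^ 2)) x := by
    intro x
    have h1 : HasDerivAt (fun x : ℝ => -a * x ^ 2) (-a * (2 * x)) x := by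
      simpa using (hasDerivAt_pow 2 x).const_mul (-a)
    refine ((P.hasDerivAt x).mul h1.exp).congr_deriv ?_
    simp only [eval_sub, eval_mul, eval_C, eval_X]
    ring
  have h0 := integral_eq_zero_of_hasDerivAt_of_integrable hd
    (integrable_polynomial_mul_gaussian ha _) (integrable_polynomial_mul_gaussian ha P)
  simp only [eval_sub, sub_mul, eval_mul (p := C _), eval_C] at h0
  rw [integral_sub (integrable_polynomial_mul_gaussian ha _)
    (by simpa only [mul_assoc] using
      (integrable_polynomial_mul_gaussian ha (X * P)).const_mul (2 * a))] at h0
  simp only [mul_assoc (2 * a)] at h0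
  rw [integral_const_mul] at h0
  linarith

theorem derivative_hermite_succ (n : ℕ) :
    derivative (hermite (n + 1)) = (n + 1 : ℤ[X]) * hermite n := by
  induction n with
  | zero => simp [hermite_succ]
  | succ n ih =>
    rw [hermite_succ (n + 1), derivative_sub, derivative_mul, derivative_X, ih, derivative_mul,
      show derivative (n + 1 : ℤ[X]) = 0 by simp]
    push_cast
    linear_combination ((n : ℤ[X]) + 1) * (hermite_succ n).symm

/-- The rescaled Hermite polynomial `He_n(√2 x)`. -/
noncomputable def scaledHermite (n : ℕ) : ℝ[X] :=
  ((hermite n).map (Int.castRingHom ℝ)).comp (C (√2) * X)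

theorem eval_scaledHermite (n : ℕ) (x : ℝ) :
    (scaledHermite n).eval x = aeval (√2 * x) (hermite n) := by
  simp [scaledHermite, aeval_def, eval_map]

theorem derivative_scaledHermite_succ (n : ℕ) :
    derivative (scaledHermite (n + 1)) = C (√2 * (n + 1)) * scaledHermite n := by
  rw [scaledHermite, derivative_comp, derivative_map, derivative_hermite_succ]
  simp [scaledHermite]
  ring

theorem scaledHermite_succ_succ (n : ℕ) :
    scaledHermite (n + 2) =
      C (√2) * (X * scaledHermite (n + 1)) - C ((n : ℝ) + 1) * scaledHermite n := by
  rw [scaledHermite, hermite_succ (n + 1), derivative_hermite_succ]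
  simp [scaledHermite]
  ring

/-- In `y = √2 x` the weight is Gaussian of variance `1/a`, and the generating function `exp(ty -
t²/2)` of `He_n` has mean `exp(t²(1/a - 1)/2)`, whence the variance `a⁻¹ - 1`. The proof compares
recurrences. -/
theorem integral_scaledHermite {a : ℝ} (ha : 0 < a) (n : ℕ) :
    ∫ x : ℝ, (scaledHermite n).eval x * Real.exp (-a * x ^ 2) =
      gaussianMoment (a⁻¹ - 1) n * √(Real.pi / a) := by
  induction n using Nat.twoStepInduction with
  | zero => simpa [scaledHermite, gaussianMoment] using integral_gaussian a
  | one =>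
    have h := integral_derivative_mul_gaussian ha (C 1)
    rw [derivative_C, C_1, mul_one] at h
    simp only [eval_zero, zero_mul, integral_zero, eval_X] at h
    have h' : ∫ x : ℝ, x * Real.exp (-a * x ^ 2) = 0 := by
      rcases mul_eq_zero.1 h.symm with h | h
      · linarith
      · exact h
    simp only [scaledHermite, hermite_one, map_X, X_comp, eval_mul, eval_C, eval_X,
      gaussianMoment, zero_mul, mul_assoc]
    rw [integral_const_mul, h', mul_zero]
  | more n ih _ =>
    have h := integral_derivative_mul_gaussian ha (scaledHermite (n + 1))
    rw [derivative_scaledHermite_succ] at h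
    simp only [eval_mul (p := C _), eval_C, mul_assoc] at h
    rw [integral_const_mul, integral_const_mul, ih] at h
    rw [scaledHermite_succ_succ]
    simp only [eval_sub, sub_mul, eval_mul (p := C _), eval_C, mul_assoc]
    rw [integral_sub ((integrable_polynomial_mul_gaussian ha _).const_mul _)
      ((integrable_polynomial_mul_gaussian ha _).const_mul _), integral_const_mul,
      integral_const_mul, ih, gaussianMoment]
    have h2 : √2 * √2 = (2 : ℝ) := Real.mul_self_sqrt (by norm_num)
    set J := ∫ x : ℝ, (X * scaledHermite (n + 1)).eval x * Real.exp (-a * x ^ 2)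
    set g := gaussianMoment (a⁻¹ - 1) n * √(Real.pi / a) with hg
    have hJ : √2 * J = a⁻¹ * ((n + 1) * g) := by
      field_simp
      have : √2 * (√2 * ((n + 1) * g)) = √2 * (2 * (a * J)) := by rw [h]
      rw [← mul_assoc, h2] at this
      linarith
    rw [hJ]
    linear_combination (-(a⁻¹ - 1) * (n + 1)) * hg

theorem squeezedVacuum_apply (r x : ℝ) :
    squeezedVacuum r x =
      ((√(Real.exp r) * (√(√Real.pi))⁻¹ * Real.exp (-(Real.exp r * x) ^ 2 / 2) : ℝ) : ℂ) := by
  have h1 : √(Real.exp (-r)) * |Real.exp (-r)|⁻¹ = √(Real.exp r) := by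
    rw [abs_of_pos (Real.exp_pos _), Real.exp_neg, Real.sqrt_inv, inv_inv]
    have := Real.mul_self_sqrt (Real.exp_pos r).le
    field_simp
    linarith
  rw [← h1]
  simp only [squeezedVacuum, squeezeGate, multiplier, fockState, physHermite, pow_zero, hermite_zero,
    Nat.factorial_zero, Nat.cast_one, map_one, one_mul, mul_one, Real.exp_neg r, div_inv_eq_mul,
    mul_comm x]
  push_cast
  ring

theorem fockCoeff_squeezedVacuum (r : ℝ) (n : ℕ) :
    fockCoeff (squeezedVacuum r) n =
      (((√(Real.cosh r))⁻¹ * (√(n ! : ℝ))⁻¹ : ℝ) : ℂ) *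
        gaussianMoment (-(Real.tanh r : ℂ)) n := by
  -- The exponents `-x²/2` of `ψ_n` and `-(e^r x)²/2` of the squeezed vacuum add up to `-a x²`.
  set a : ℝ := (1 + Real.exp r ^ 2) / 2 with ha_def
  have ha : 0 < a := by positivity
  have h1 : ∀ x : ℝ, (starRingEnd ℂ) (fockState n x) * squeezedVacuum r x =
      (((√(Real.exp r) * (√(√Real.pi))⁻¹ * (√(2 ^ n * n ! * √Real.pi))⁻¹ * (√2) ^ n) *
        ((scaledHermite n).eval x * Real.exp (-a * x ^ 2)) : ℝ) : ℂ) := by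
    intro x
    rw [squeezedVacuum_apply, fockState, Complex.conj_ofReal, ← Complex.ofReal_mul, physHermite,
      eval_scaledHermite, show -a * x ^ 2 = -x ^ 2 / 2 + -(Real.exp r * x) ^ 2 / 2 by
        rw [ha_def]; ring, Real.exp_add]
    congr 1
    ring
  have h2 : a⁻¹ - 1 = -Real.tanh r := by
    rw [Real.tanh_eq_sinh_div_cosh, Real.sinh_eq, Real.cosh_eq, Real.exp_neg, ha_def]
    have := Real.exp_pos r
    field_simp
    ring
  have h3 : √(Real.exp r) * √(a⁻¹) = (√(Real.cosh r))⁻¹ := by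
    rw [← Real.sqrt_mul (Real.exp_pos r).le, ← Real.sqrt_inv]
    congr 1
    rw [Real.cosh_eq, Real.exp_neg, ha_def]
    have := Real.exp_pos r
    field_simp
    ring
  have hpi : (0 : ℝ) < Real.pi := Real.pi_pos
  rw [fockCoeff]
  simp only [h1]
  rw [integral_complex_ofReal, integral_const_mul, integral_scaledHermite ha, h2,
    ← Complex.ofReal_neg, ← gaussianMoment_ofReal, ← Complex.ofReal_mul, ← h3, div_eq_mul_inv,
    Real.sqrt_mul hpi.le, Real.sqrt_mul (by positivity), Real.sqrt_mul (by positivity)]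
  congr 1
  have h4 : √(√Real.pi) * √(√Real.pi) = √Real.pi := Real.mul_self_sqrt (Real.sqrt_nonneg _)
  have h5 : √((2 : ℝ) ^ n) = √2 ^ n := by
    rw [Real.sqrt_eq_iff_mul_self_eq (by positivity) (by positivity), ← mul_pow,
      Real.mul_self_sqrt zero_le_two]
  have : 0 < √(√Real.pi) := by positivity
  rw [h5]
  generalize √(√Real.pi) = q at *
  rw [← h4]
  field_simp

end Gaussian

/-! ### Laplace expansion of the hafnian -/

section Hafnian

open Finset

open Classical in
/-- The pairings of the finite set `S`, as finite sets of unordered pairs. -/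
noncomputable def pairingsOn {ι : Type*} (S : Finset ι) : Finset (Finset (Sym2 ι)) :=
  S.sym2.powerset.filter fun M => (∀ e ∈ M, ¬ e.IsDiag) ∧ ∀ v ∈ S, ∃! e, e ∈ M ∧ v ∈ e

theorem mem_pairingsOn {ι : Type*} {S : Finset ι} {M : Finset (Sym2 ι)} :
    M ∈ pairingsOn S ↔ (∀ e ∈ M, ∀ v ∈ e, v ∈ S) ∧ (∀ e ∈ M, ¬ e.IsDiag) ∧
      ∀ v ∈ S, ∃! e, e ∈ M ∧ v ∈ e := by
  classical
  simp [pairingsOn, Finset.subset_iff, Finset.mem_sym2_iff]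

theorem pairingsOn_empty {ι : Type*} : pairingsOn (∅ : Finset ι) = {∅} := by
  classical
  ext M
  rw [mem_pairingsOn, Finset.mem_singleton]
  constructor
  · rintro ⟨h, -, -⟩
    refine Finset.eq_empty_of_forall_notMem fun e he => ?_
    induction e with
    | _ x y => exact absurd (h _ he x (Sym2.mem_mk_left x y)) (Finset.notMem_empty x)
  · rintro rfl
    simp

/-- Erasing the pair of `v` and `insert_mem_pairingsOn` are the two directions of the bijection
behind `sum_pairingsOn_eq`. -/
theorem erase_mem_pairingsOn {ι : Type*} [DecidableEq ι] {S : Finset ι} {M : Finset (Sym2 ι)}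
    {v w : ι} (hM : M ∈ pairingsOn S) (he : s(v, w) ∈ M) :
    M.erase s(v, w) ∈ pairingsOn ((S.erase v).erase w) := by
  rw [mem_pairingsOn] at hM ⊢
  obtain ⟨h1, h2, h3⟩ := hM
  have hv := h1 _ he v (Sym2.mem_mk_left v w)
  have hw := h1 _ he w (Sym2.mem_mk_right v w)
  refine ⟨fun e hem u hu => ?_, fun e hem => h2 e (mem_of_mem_erase hem), fun u hu => ?_⟩
  · obtain ⟨hne, heM⟩ := mem_erase.1 hem
    refine mem_erase.2 ⟨?_, mem_erase.2 ⟨?_, h1 e heM u hu⟩⟩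
    · rintro rfl
      exact hne ((h3 u hw).unique ⟨heM, hu⟩ ⟨he, Sym2.mem_mk_right v u⟩)
    · rintro rfl
      exact hne ((h3 u hv).unique ⟨heM, hu⟩ ⟨he, Sym2.mem_mk_left u w⟩)
  · simp only [mem_erase] at hu
    obtain ⟨huw, huv, huS⟩ := hu
    obtain ⟨e, ⟨hem, hue⟩, huniq⟩ := h3 u huS
    refine ⟨e, ⟨mem_erase.2 ⟨?_, hem⟩, hue⟩, fun f hf => huniq f ⟨mem_of_mem_erase hf.1, hf.2⟩⟩
    rintro rfl
    rcases Sym2.mem_iff.1 hue with h | h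
    · exact huv h
    · exact huw h

theorem insert_mem_pairingsOn {ι : Type*} [DecidableEq ι] {S : Finset ι} {M : Finset (Sym2 ι)}
    {v w : ι} (hv : v ∈ S) (hw : w ∈ S) (hvw : v ≠ w)
    (hM : M ∈ pairingsOn ((S.erase v).erase w)) :
    s(v, w) ∉ M ∧ insert s(v, w) M ∈ pairingsOn S := by
  rw [mem_pairingsOn] at hM ⊢
  obtain ⟨h1, h2, h3⟩ := hM
  have hvM : ∀ e ∈ M, v ∉ e := fun e he h => by simpa using h1 e he v h
  have hwM : ∀ e ∈ M, w ∉ e := fun e he h => by simpa using h1 e he w h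
  refine ⟨fun h => hvM _ h (Sym2.mem_mk_left v w), ?_, ?_, ?_⟩
  · intro e he u hu
    rcases mem_insert.1 he with rfl | he
    · rcases Sym2.mem_iff.1 hu with rfl | rfl <;> assumption
    · exact mem_of_mem_erase (mem_of_mem_erase (h1 e he u hu))
  · intro e he
    rcases mem_insert.1 he with rfl | he
    · simpa using hvw
    · exact h2 e he
  · intro u hu
    by_cases h : u = v ∨ u = w
    · refine ⟨s(v, w), ⟨mem_insert_self _ _, Sym2.mem_iff.2 h⟩, ?_⟩
      rintro f ⟨hf, huf⟩
      rcases mem_insert.1 hf with rfl | hfM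
      · rfl
      · rcases h with rfl | rfl
        · exact absurd huf (hvM f hfM)
        · exact absurd huf (hwM f hfM)
    · push Not at h
      obtain ⟨e, ⟨hem, hue⟩, huniq⟩ := h3 u (mem_erase.2 ⟨h.2, mem_erase.2 ⟨h.1, hu⟩⟩)
      refine ⟨e, ⟨mem_insert_of_mem hem, hue⟩, ?_⟩
      rintro f ⟨hf, huf⟩
      rcases mem_insert.1 hf with rfl | hf
      · rcases Sym2.mem_iff.1 huf with h' | h'
        · exact absurd h' h.1
        · exact absurd h' h.2
      · exact huniq f ⟨hf, huf⟩

/-- Expansion of a sum over pairings along the partner `w` of a fixed element `v`. -/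
theorem sum_pairingsOn_eq {ι R : Type*} [DecidableEq ι] [CommRing R] (f : Sym2 ι → R)
    {S : Finset ι} {v : ι} (hv : v ∈ S) :
    ∑ M ∈ pairingsOn S, ∏ e ∈ M, f e =
      ∑ w ∈ S.erase v, f s(v, w) * ∑ M ∈ pairingsOn ((S.erase v).erase w), ∏ e ∈ M, f e := by
  simp only [mul_sum]
  rw [sum_sigma']
  symm
  refine sum_bij (fun x _ => insert s(v, x.1) x.2) ?_ ?_ ?_ ?_
  · rintro ⟨w, M⟩ h
    obtain ⟨hw, hM⟩ := mem_sigma.1 h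
    exact (insert_mem_pairingsOn hv (mem_of_mem_erase hw) (ne_of_mem_erase hw).symm hM).2
  · rintro ⟨w, M⟩ h ⟨w', M'⟩ h' heq
    obtain ⟨hw, hM⟩ := mem_sigma.1 h
    obtain ⟨hw', hM'⟩ := mem_sigma.1 h'
    have hi := insert_mem_pairingsOn hv (mem_of_mem_erase hw) (ne_of_mem_erase hw).symm hM
    have hi' := insert_mem_pairingsOn hv (mem_of_mem_erase hw') (ne_of_mem_erase hw').symm hM'
    dsimp only at heq hi hi'
    have hu := (mem_pairingsOn.1 hi.2).2.2 v hv
    -- Both pairs contain `v` and lie in the same pairing.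
    have : s(v, w) = s(v, w') := hu.unique ⟨mem_insert_self _ _, Sym2.mem_mk_left _ _⟩
      ⟨heq ▸ mem_insert_self _ _, Sym2.mem_mk_left _ _⟩
    obtain rfl : w = w' := Sym2.congr_right.1 this
    obtain rfl : M = M' := by rw [← erase_insert hi.1, heq, erase_insert hi'.1]
    rfl
  · intro M hM
    obtain ⟨-, h2, h3⟩ := mem_pairingsOn.1 hM
    obtain ⟨e, ⟨heM, hve⟩, -⟩ := h3 v hv
    obtain ⟨w, rfl⟩ := Sym2.mem_iff_exists.1 hve
    have hwv : w ≠ v := fun h => h2 _ heM (by simp [h])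
    refine ⟨⟨w, M.erase s(v, w)⟩, mem_sigma.2 ⟨mem_erase.2 ⟨hwv, ?_⟩,
      erase_mem_pairingsOn hM heM⟩, insert_erase heM⟩
    exact (mem_pairingsOn.1 hM).1 _ heM w (Sym2.mem_mk_right v w)
  · rintro ⟨w, M⟩ h
    obtain ⟨hw, hM⟩ := mem_sigma.1 h
    exact (prod_insert
      (insert_mem_pairingsOn hv (mem_of_mem_erase hw) (ne_of_mem_erase hw).symm hM).1).symm

/-- Working with subsets of `ι` allows induction by deleting two indices without changing the index
type. -/
theorem hafnian_eq_sum_pairingsOn {ι : Type*} [Fintype ι] (A : Matrix ι ι ℂ) (hA : A.IsSymm) :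
    hafnian A hA = ∑ M ∈ pairingsOn (univ : Finset ι),
      ∏ e ∈ M, Sym2.lift ⟨fun i j => A i j, fun i j => (hA.apply i j).symm⟩ e := by
  classical
  rw [hafnian]
  refine sum_congr ?_ fun _ _ => rfl
  ext M
  rw [mem_filter, mem_pairingsOn, IsPairing]
  simp

end Hafnian

/-! ### Wick's theorem -/

section Wick

open MvPolynomial

/-- The expectation functional of independent centred Gaussians of (formal) variances `x i`. -/
noncomputable def gaussianFunctional {σ R : Type*} [Fintype σ] [CommRing R] (x : σ → R) :
    MvPolynomial σ R →ₗ[R] R :=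
  (basisMonomials σ R).constr R fun m => ∏ i, gaussianMoment (x i) (m i)

theorem gaussianFunctional_monomial {σ R : Type*} [Fintype σ] [CommRing R] (x : σ → R)
    (m : σ →₀ ℕ) (a : R) :
    gaussianFunctional x (monomial m a) = a * ∏ i, gaussianMoment (x i) (m i) := by
  have h : monomial m a = a • basisMonomials σ R m := by
    simp [smul_monomial]
  rw [h, map_smul, gaussianFunctional, Module.Basis.constr_basis, smul_eq_mul]

/-- Gaussian integration by parts. -/
theorem gaussianFunctional_X_mul {σ R : Type*} [Fintype σ] [CommRing R] (x : σ → R) (i : σ)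
    (p : MvPolynomial σ R) :
    gaussianFunctional x (X i * p) = x i * gaussianFunctional x (pderiv i p) := by
  classical
  induction p using MvPolynomial.induction_on' with
  | add p q hp hq => rw [mul_add, map_add, hp, hq, map_add, map_add, mul_add]
  | monomial m a =>
    rw [X, monomial_mul, one_mul, pderiv_monomial, gaussianFunctional_monomial,
      gaussianFunctional_monomial, ← Finset.mul_prod_erase _ _ (Finset.mem_univ i),
      ← Finset.mul_prod_erase (a := i) _ (fun j => gaussianMoment (x j)
        ((m - Finsupp.single i 1 : σ →₀ ℕ) j)) (Finset.mem_univ i)]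
    have h : ∀ j ∈ Finset.univ.erase i,
        gaussianMoment (x j) ((Finsupp.single i 1 + m : σ →₀ ℕ) j) =
          gaussianMoment (x j) ((m - Finsupp.single i 1 : σ →₀ ℕ) j) := by
      intro j hj
      have hj : i ≠ j := (Finset.ne_of_mem_erase hj).symm
      simp [hj]
    rw [Finset.prod_congr rfl h]
    simp only [Finsupp.add_apply, Finsupp.single_eq_same, Finsupp.tsub_apply]
    -- For exponent `0` the left side is a first moment and the derivative vanishes; otherwise this
    -- is the recursion of `gaussianMoment`.
    rcases hm : m i with _ | k
    · simp [gaussianMoment]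
    · rw [show 1 + (k + 1) = k + 2 by ring, gaussianMoment, Nat.add_sub_cancel]
      push_cast
      ring

theorem derivation_prod {R A ι : Type*} [CommRing R] [CommRing A] [Algebra R A] [DecidableEq ι]
    (D : Derivation R A A) (g : ι → A) (S : Finset ι) :
    D (∏ v ∈ S, g v) = ∑ v ∈ S, (∏ w ∈ S.erase v, g w) • D (g v) := by
  induction S using Finset.induction_on with
  | empty => simp
  | insert a S ha ih =>
    rw [Finset.prod_insert ha, Derivation.leibniz, ih, Finset.sum_insert ha,
      Finset.erase_insert ha, Finset.smul_sum, add_comm]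
    congr 1
    refine Finset.sum_congr rfl fun v hv => ?_
    have hav : a ≠ v := fun h => ha (h ▸ hv)
    rw [Finset.erase_insert_of_ne hav,
      Finset.prod_insert fun h => ha (Finset.mem_of_mem_erase h), mul_smul, smul_eq_mul]

/-- Wick's theorem: the expectation of a product of linear forms is a sum over pairings. -/
theorem gaussianFunctional_prod_linear {σ ι R : Type*} [Fintype σ] [CommRing R] (x : σ → R)
    (u : ι → σ → R) (f : Sym2 ι → R) (hf : ∀ v w, f s(v, w) = ∑ i, u v i * x i * u w i)
    (S : Finset ι) :
    gaussianFunctional x (∏ v ∈ S, ∑ i, C (u v i) * X i) =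
      ∑ M ∈ pairingsOn S, ∏ e ∈ M, f e := by
  classical
  induction S using Finset.strongInduction with
  | _ S ih =>
    rcases S.eq_empty_or_nonempty with rfl | ⟨v, hv⟩
    · rw [pairingsOn_empty, Finset.prod_empty, Finset.sum_singleton, Finset.prod_empty,
        ← C_1, ← monomial_zero', gaussianFunctional_monomial]
      simp [gaussianMoment]
    · have hd : ∀ (i : σ) (w : ι), pderiv i (∑ j, C (u w j) * X j) = C (u w i) := by
        intro i w
        simp [pderiv_X, Pi.single_apply]
      rw [sum_pairingsOn_eq f hv, ← Finset.mul_prod_erase _ _ hv, Finset.sum_mul, map_sum]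
      -- Integration by parts against `X i` differentiates each remaining factor `w` in turn;
      -- summing over `i` later yields the covariance `f s(v, w)`.
      have h1 : ∀ i, gaussianFunctional x (C (u v i) * X i *
          ∏ w ∈ S.erase v, ∑ j, C (u w j) * X j) =
          ∑ w ∈ S.erase v, u v i * x i * u w i *
            ∑ M ∈ pairingsOn ((S.erase v).erase w), ∏ e ∈ M, f e := by
        intro i
        rw [mul_assoc, ← smul_eq_C_mul, map_smul, gaussianFunctional_X_mul, derivation_prod,
          map_sum, smul_eq_mul, Finset.mul_sum, Finset.mul_sum]
        refine Finset.sum_congr rfl fun w hw => ?_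
        rw [hd, smul_eq_mul, mul_comm _ (C _), ← smul_eq_C_mul, map_smul, smul_eq_mul,
          ih _ ((Finset.erase_subset _ _).trans_ssubset (Finset.erase_ssubset hv))]
        ring
      rw [Finset.sum_congr rfl fun i _ => h1 i, Finset.sum_comm]
      refine Finset.sum_congr rfl fun w _ => ?_
      rw [hf, Finset.sum_mul]

end Wick

/-! ### The amplitude as a Gaussian expectation -/

section Amplitude

open Finset

/-- A pairing of `S` has `#S / 2` members; for odd `#S` there is none and both sides vanish. -/
theorem sum_pairingsOn_neg {ι R : Type*} [CommRing R] (f : Sym2 ι → R) (S : Finset ι) :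
    ∑ M ∈ pairingsOn S, ∏ e ∈ M, -f e =
      (-1) ^ (#S / 2) * ∑ M ∈ pairingsOn S, ∏ e ∈ M, f e := by
  classical
  induction S using Finset.strongInduction with
  | _ S ih =>
    rcases S.eq_empty_or_nonempty with rfl | ⟨v, hv⟩
    · simp [pairingsOn_empty]
    · rw [sum_pairingsOn_eq f hv, sum_pairingsOn_eq (fun e => -f e) hv, mul_sum]
      refine sum_congr rfl fun w hw => ?_
      have h1 := card_erase_add_one hv
      have h2 := card_erase_add_one hw
      rw [ih _ ((erase_subset _ _).trans_ssubset (erase_ssubset hv)),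
        show #S / 2 = #((S.erase v).erase w) / 2 + 1 by lia, pow_succ]
      ring

theorem wNode_sum {κ : Type*} [Fintype κ] (k : κ → ℕ) :
    wNode (∑ a, k a) k =
      ((√((∑ a, k a)! : ℝ) * ∏ a, (√((k a)! : ℝ))⁻¹ : ℝ) : ℂ) := by
  rw [wNode, if_pos rfl, Real.sqrt_div (Nat.cast_nonneg _),
    Real.sqrt_prod _ fun _ _ => Nat.cast_nonneg _, prod_inv_distrib, div_eq_mul_inv]

/-- The labelling of the internal wires determined by the numbers `p j i` of photons travelling
from input `i` to output `j`. -/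
def wireLabelling {s : ℕ} (p : Fin s → Fin s → ℕ) :
    (Fin s → ℕ) × (Fin s × Fin s → ℕ) × (Fin s × Fin s → ℕ) :=
  (fun i => ∑ j, p j i, fun e => p e.2 e.1, fun e => p e.2 e.1)

theorem wireLabelling_injective {s : ℕ} :
    Function.Injective (wireLabelling : (Fin s → Fin s → ℕ) → _) := by
  intro p q h
  funext j i
  exact congrFun (congrArg (fun w => w.2.1) h) (i, j)

/-- The possible photon transfer numbers for the observed photon numbers `n`. -/
def photonTransfers {s : ℕ} (n : Fin s → ℕ) : Finset (Fin s → Fin s → ℕ) :=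
  Fintype.piFinset fun j => piAntidiag univ (n j)

theorem mem_photonTransfers {s : ℕ} {n : Fin s → ℕ} {p : Fin s → Fin s → ℕ} :
    p ∈ photonTransfers n ↔ ∀ j, ∑ i, p j i = n j := by
  simp [photonTransfers]

/-- The spiders force equal labels along each wire, the output nodes fix the sums at each output,
and the input nodes determine the rest. -/
theorem gbsTerm_eq_zero {s : ℕ} (U : Matrix (Fin s) (Fin s) ℂ) (r : Fin s → ℝ) (n : Fin s → ℕ)
    {w : (Fin s → ℕ) × (Fin s × Fin s → ℕ) × (Fin s × Fin s → ℕ)}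
    (hw : w ∉ (photonTransfers n).image wireLabelling) : gbsTerm U r n w = 0 := by
  by_contra h
  apply hw
  obtain ⟨m, k, l⟩ := w
  simp only [gbsTerm, mul_eq_zero, not_or, prod_eq_zero_iff, mem_univ, true_and, not_exists,
    wNode, fockSpider, ite_eq_right_iff, not_forall, exists_prop] at h
  obtain ⟨⟨⟨-, hm⟩, hkl⟩, hn⟩ := h
  obtain rfl : k = l := funext fun e => (hkl e).1
  refine mem_image.2 ⟨fun j i => k (i, j), mem_photonTransfers.2 fun j => (hn j).1.symm, ?_⟩
  simp only [wireLabelling, Prod.mk.eta, Prod.mk.injEq, and_true]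
  exact funext fun i => (hm i).1.symm

theorem gbsTerm_wireLabelling {s : ℕ} (U : Matrix (Fin s) (Fin s) ℂ) (r : Fin s → ℝ)
    {n : Fin s → ℕ} {p : Fin s → Fin s → ℕ} (hp : p ∈ photonTransfers n) :
    gbsTerm U r n (wireLabelling p) =
      (((∏ i, (√(Real.cosh (r i)))⁻¹) * ∏ i, (√((n i)! : ℝ))⁻¹ : ℝ) : ℂ) *
        ((∏ j, ((Nat.multinomial univ (p j) : ℂ) * ∏ i, U j i ^ p j i)) *
          ∏ i, gaussianMoment (-(Real.tanh (r i) : ℂ)) (∑ j, p j i)) := by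
  rw [mem_photonTransfers] at hp
  have hn : ∀ j, wNode (n j) (fun i => p j i) =
      ((√((n j)! : ℝ) * ∏ i, (√((p j i)! : ℝ))⁻¹ : ℝ) : ℂ) := by
    intro j
    rw [← hp j, wNode_sum]
  have hmult : ∀ j, (((n j)! : ℝ) : ℂ) * ∏ i, (((p j i)! : ℝ) : ℂ)⁻¹ =
      (Nat.multinomial univ (p j) : ℂ) := by
    intro j
    have h := Nat.multinomial_spec univ (p j)
    rw [hp j] at h
    have h0 : ∏ i, (((p j i)! : ℝ) : ℂ) ≠ 0 := prod_ne_zero_iff.2 fun i _ => by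
      exact_mod_cast Nat.factorial_ne_zero _
    rw [prod_inv_distrib, ← div_eq_mul_inv, div_eq_iff h0, ← h]
    push_cast
    ring
  have hsq : ∀ k : ℕ, ((√(k ! : ℝ) : ℝ) : ℂ) * ((√(k ! : ℝ) : ℝ) : ℂ) = ((k ! : ℝ) : ℂ) := by
    intro k
    rw [← Complex.ofReal_mul, Real.mul_self_sqrt (Nat.cast_nonneg _)]
  have hne : ∀ k : ℕ, ((√(k ! : ℝ) : ℝ) : ℂ) ≠ 0 := by
    intro k
    exact_mod_cast (Real.sqrt_pos.2 (Nat.cast_pos.2 k.factorial_pos)).ne'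
  have hU : ∏ e : Fin s × Fin s, U e.2 e.1 ^ p e.2 e.1 = ∏ j, ∏ i, U j i ^ p j i := by
    rw [Fintype.prod_prod_type, prod_comm]
  simp only [gbsTerm, wireLabelling, fockCoeff_squeezedVacuum, wNode_sum, hn, fockSpider, if_true,
    hU]
  -- At input `i` the `√(m!)` of the splitting node cancels the `1/√(m!)` of the Fock coefficient.
  rw [← prod_mul_distrib, prod_congr rfl fun i _ => show
    (((√(Real.cosh (r i)))⁻¹ * (√((∑ j, p j i)! : ℝ))⁻¹ : ℝ) : ℂ) *
        gaussianMoment (-(Real.tanh (r i) : ℂ)) (∑ j, p j i) *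
      ((√((∑ j, p j i)! : ℝ) * ∏ j, (√((p j i)! : ℝ))⁻¹ : ℝ) : ℂ) =
    (((√(Real.cosh (r i)))⁻¹ : ℝ) : ℂ) * gaussianMoment (-(Real.tanh (r i) : ℂ)) (∑ j, p j i) *
      ∏ j, ((√((p j i)! : ℝ) : ℝ) : ℂ)⁻¹ by
        have := hne (∑ j, p j i)
        push_cast
        field_simp]
  rw [prod_mul_distrib, prod_mul_distrib, prod_comm (f := fun i j => ((√((p j i)! : ℝ) : ℝ) : ℂ)⁻¹)]
  -- Each `1/√(p j i)!` occurs twice, from the splitting and the merging node; with `√(n!) =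
  -- n!/√(n!)` this gives a multinomial coefficient.
  have hj : ∀ j, (∏ i, ((√((p j i)! : ℝ) : ℝ) : ℂ)⁻¹) *
      ((√((n j)! : ℝ) * ∏ i, (√((p j i)! : ℝ))⁻¹ : ℝ) : ℂ) =
      (((√((n j)! : ℝ))⁻¹ : ℝ) : ℂ) * (Nat.multinomial univ (p j) : ℂ) := by
    intro j
    rw [← hmult j, ← hsq (n j)]
    simp only [← hsq (p j _), mul_inv, prod_mul_distrib]
    have := hne (n j)
    push_cast
    field_simp
  have hj' := prod_congr (s₁ := (univ : Finset (Fin s))) rfl fun j _ => hj j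
  rw [prod_mul_distrib, prod_mul_distrib] at hj'
  rw [prod_mul_distrib, Complex.ofReal_mul, Complex.ofReal_prod, Complex.ofReal_prod]
  linear_combination (∏ i, (((√(Real.cosh (r i)))⁻¹ : ℝ) : ℂ)) *
    (∏ i, gaussianMoment (-(Real.tanh (r i) : ℂ)) (∑ j, p j i)) *
    (∏ j, ∏ i, U j i ^ p j i) * hj'

open MvPolynomial in
-- The multinomial theorem at each output `j`; the variable `X i` collects total exponent `∑ j, p j
-- i`, the photon number at input `i`.
theorem gaussianFunctional_prod_pow {s : ℕ} (U : Matrix (Fin s) (Fin s) ℂ) (x : Fin s → ℂ)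
    (n : Fin s → ℕ) :
    gaussianFunctional x (∏ j, (∑ i, C (U j i) * X i) ^ n j) =
      ∑ p ∈ photonTransfers n, (∏ j, ((Nat.multinomial univ (p j) : ℂ) * ∏ i, U j i ^ p j i)) *
        ∏ i, gaussianMoment (x i) (∑ j, p j i) := by
  simp only [sum_pow_eq_sum_piAntidiag]
  rw [prod_univ_sum, map_sum]
  refine sum_congr rfl fun p _ => ?_
  have h : ∏ j, ((Nat.multinomial univ (p j) : MvPolynomial (Fin s) ℂ) *
      ∏ i, (C (U j i) * X i) ^ p j i) =
      monomial (Finsupp.equivFunOnFinite.symm fun i => ∑ j, p j i)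
        (∏ j, ((Nat.multinomial univ (p j) : ℂ) * ∏ i, U j i ^ p j i)) := by
    rw [monomial_eq, Finsupp.prod_fintype _ _ fun _ => pow_zero _]
    simp only [Finsupp.equivFunOnFinite_symm_apply_apply, mul_pow, prod_mul_distrib, map_mul,
      map_prod, map_natCast, map_pow, ← prod_pow_eq_pow_sum]
    rw [prod_comm (f := fun j i => (X i : MvPolynomial (Fin s) ℂ) ^ p j i), mul_assoc]
  rw [h, gaussianFunctional_monomial]
  rfl

theorem gaussianFunctional_eq_hafnian {s : ℕ} (U : Matrix (Fin s) (Fin s) ℂ) (r : Fin s → ℝ)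
    (n : Fin s → ℕ) :
    gaussianFunctional (fun i => -(Real.tanh (r i) : ℂ))
        (∏ j, (∑ i, MvPolynomial.C (U j i) * MvPolynomial.X i) ^ n j) =
      (-1) ^ ((∑ i, n i) / 2) *
        hafnian (repeatMatrix (gbsMatrix U r) n)
          (repeatMatrix_isSymm (gbsMatrix_isSymm _ r) n) := by
  have hA : ∀ i j, gbsMatrix U r i j = ∑ k, U i k * (Real.tanh (r k) : ℂ) * U j k := by
    intro i j
    simp [gbsMatrix, Matrix.mul_apply, Matrix.diagonal_apply]
  -- The power `n j` is read as a product over the `n j` copies of the index `j`, so Wick's theorem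
  -- produces the repeated rows and columns.
  rw [hafnian_eq_sum_pairingsOn, show ∑ i, n i = #(univ : Finset (Σ i, Fin (n i))) by simp,
    ← sum_pairingsOn_neg, ← gaussianFunctional_prod_linear (fun i => -(Real.tanh (r i) : ℂ))
      (fun v : Σ i, Fin (n i) => U v.1)]
  · rw [Fintype.prod_sigma]
    simp
  · intro v w
    simp [repeatMatrix, hA, Sym2.lift_mk]

theorem hasSum_gbsTerm {s : ℕ} (U : Matrix (Fin s) (Fin s) ℂ) (r : Fin s → ℝ) (n : Fin s → ℕ) :
    HasSum (gbsTerm U r n)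
      ((-1) ^ ((∑ i, n i) / 2) *
        (((∏ i, (√(Real.cosh (r i)))⁻¹) * ∏ i, (√((n i)! : ℝ))⁻¹ : ℝ) : ℂ) *
        hafnian (repeatMatrix (gbsMatrix U r) n)
          (repeatMatrix_isSymm (gbsMatrix_isSymm _ r) n)) := by
  have h := hasSum_sum_of_ne_finset_zero (L := SummationFilter.unconditional _)
    fun w hw => gbsTerm_eq_zero U r n (w := w) hw
  rw [sum_image wireLabelling_injective.injOn,
    sum_congr rfl fun p hp => gbsTerm_wireLabelling U r hp, ← mul_sum,
    ← gaussianFunctional_prod_pow, gaussianFunctional_eq_hafnian, mul_left_comm, ← mul_assoc] at h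
  exact h

end Amplitude

theorem mainTheorem2 (s : ℕ) (U : Matrix.unitaryGroup (Fin s) ℂ) (r : Fin s → ℝ)
    (n : Fin s → ℕ) :
    Summable (gbsTerm (U : Matrix (Fin s) (Fin s) ℂ) r n) ∧
    gbsAmplitude (U : Matrix (Fin s) (Fin s) ℂ) r n =
      (-1) ^ ((∑ i, n i) / 2) *
        (((∏ i, (√(Real.cosh (r i)))⁻¹) * ∏ i, (√((n i)! : ℝ))⁻¹ : ℝ) : ℂ) *
        hafnian (repeatMatrix (gbsMatrix (U : Matrix (Fin s) (Fin s) ℂ) r) n)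
          (repeatMatrix_isSymm (gbsMatrix_isSymm _ r) n) :=
  ⟨(hasSum_gbsTerm _ r n).summable, (hasSum_gbsTerm _ r n).tsum_eq⟩
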